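/- A left semi-brace is a set $B$ with two binary operations $+$ and $\circ$ such that $(B,+)$ is a semigroup, $(B,\circ)$ is a group, and $a\circ(b+c)=a\circ b+a\circ(a^-+c)$ for all $a,b,c\in B$, where $a^-$ is the inverse of $a$ in $(B,\circ)$. It is left cancellative if $a+b=a+c$ implies $b=c$. Write $0$ for the neutral element of $(B,\circ)$, $E$ for the set of idempotents of $(B,+)$, and $G=B+0=\{b+0 : b\in B\}$, which is a subgroup of $(B,\circ)$ when $B$ is left cancellative. An isomorphism of left semi-braces is a bijection respecting both operations. Theorem. Let $p>2$ be a prime. There is exactly one injective homomorphism $\alpha$ from $(\mathbb{Z}/2\mathbb{Z},+)$ to $\mathrm{Aut}(\mathbb{Z}/p^2\mathbb{Z},+)$. Let $B$ be a left cancellative left semi-brace of size $2p^2$ with $|E|=2$ and $(G,\circ)$ cyclic. Then $B$ is isomorphic to one of the following left cancellative left semi-braces on the set $\mathbb{Z}/p^2\mathbb{Z}\times\mathbb{Z}/2\mathbb{Z}$, in each of which $(g_1,e_1)+(g_2,e_2)=(g_1+g_2,e_2)$: 1. $(g_1,e_1)\circ(g_2,e_2)=(g_1+\alpha_{e_1}(g_2),\,e_1+e_2)$;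 2. $(g_1,e_1)\circ(g_2,e_2)=(g_1+g_2,\,e_1+e_2)$; 3. $(g_1,e_1)\circ(g_2,e_2)=(g_1+g_2+p\,g_1g_2,\,e_1+e_2)$. Conversely, each of these three is a left cancellative left semi-brace of size $2p^2$ with $E=\{0\}\times\mathbb{Z}/2\mathbb{Z}$ (so $|E|=2$), $G=\mathbb{Z}/p^2\mathbb{Z}\times\{0\}$ and $(G,\circ)$ cyclic; the group $(B,\circ)$ is isomorphic to $\mathbb{Z}/p^2\mathbb{Z}\rtimes_\alpha\mathbb{Z}/2\mathbb{Z}$ in case 1 and to $\mathbb{Z}/p^2\mathbb{Z}\times\mathbb{Z}/2\mathbb{Z}$ in cases 2 and 3; and no two of the three are isomorphic. -/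

import Mathlib

/-- A left semi-brace: a semigroup `(B, +)` and a group `(B, ∘)` on the same set with
`a ∘ (b + c) = a ∘ b + a ∘ (a⁻ + c)`. The group operation `∘` is written `*`, so the neutral
element of `∘` is written `1`; nothing relates it to an additive unit by definition.
A left semi-brace is left cancellative when `IsLeftCancelAdd B` holds. -/
class LeftSemiBrace (B : Type*) extends AddSemigroup B, Group B where
  mul_add_eq : ∀ a b c : B, a * (b + c) = a * b + a * (a⁻¹ + c)

namespace LeftSemiBrace

/-- The set `E` of idempotents of `(B, +)`. -/
def E (B : Type*) [LeftSemiBrace B] : Set B := {e | e + e = e}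

section Structure

variable {B : Type*} [LeftSemiBrace B]

/-- The map `λ_a(b) = a ∘ (a⁻ + b)`. -/
def lam (a b : B) : B := a * (a⁻¹ + b)

theorem lam_one_left [IsLeftCancelAdd B] (c : B) : lam 1 c = c := by
  have h := mul_add_eq (1 : B) 1 c
  simp only [one_mul, inv_one] at h
  have h2 := add_left_cancel h
  simp only [lam, one_mul, inv_one]
  exact h2.symm

theorem one_add_eq [IsLeftCancelAdd B] (c : B) : (1 : B) + c = c := by
  have h := lam_one_left c
  simpa only [lam, one_mul, inv_one] using h

theorem add_lam [IsLeftCancelAdd B] (a c : B) : a + lam a c = a * c := by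
  have h := mul_add_eq a 1 c
  rw [one_add_eq, mul_one] at h
  exact h.symm

theorem lam_mul (a b c : B) : lam (a * b) c = lam a (lam b c) := by
  have h := mul_add_eq b (b⁻¹ * a⁻¹) c
  rw [mul_inv_cancel_left] at h
  unfold lam
  rw [mul_inv_rev, mul_assoc, h]

/-- An element `a` is of the form `b + 1` (where `1` is the neutral element of `∘`) if and only
if `λ_a` fixes `1`. -/
theorem exists_add_one_iff [IsLeftCancelAdd B] (a : B) :
    (∃ b : B, b + 1 = a) ↔ lam a 1 = 1 := by
  have h := add_lam a 1
  rw [mul_one] at h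
  constructor
  · rintro ⟨b, hb⟩
    have h1 : a + 1 = a := by rw [← hb, add_assoc, one_add_eq]
    exact add_left_cancel (h.trans h1.symm)
  · intro h1
    exact ⟨a, by rw [h1] at h; exact h⟩

variable (B)

/-- The subgroup `G = B + 0` of `(B, ∘)`, where `0` is the neutral element of `∘`
(written `1` here). -/
def G [IsLeftCancelAdd B] : Subgroup B where
  carrier := {a | ∃ b : B, b + 1 = a}
  one_mem' := ⟨1, one_add_eq 1⟩
  mul_mem' := by
    intro a b ha hb
    have ha' := (exists_add_one_iff a).1 ha
    have hb' := (exists_add_one_iff b).1 hb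
    exact (exists_add_one_iff (a * b)).2 (by rw [lam_mul, hb', ha'])
  inv_mem' := by
    intro a ha
    have ha' := (exists_add_one_iff a).1 ha
    refine (exists_add_one_iff a⁻¹).2 ?_
    have h := lam_mul a⁻¹ a 1
    rw [inv_mul_cancel, lam_one_left, ha'] at h
    exact h.symm

end Structure

/-- Two left semi-braces are isomorphic if some bijection respects both operations. -/
def Isomorphic (B C : Type*) [LeftSemiBrace B] [LeftSemiBrace C] : Prop :=
  ∃ f : B ≃ C, (∀ x y : B, f (x + y) = f x + f y) ∧ (∀ x y : B, f (x * y) = f x * f y)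

end LeftSemiBrace

/-- The set `ℤ/p²ℤ × ℤ/2ℤ`, with
`(g₁, e₁) + (g₂, e₂) = (g₁ + g₂, e₂)` and
`(g₁, e₁) ∘ (g₂, e₂) = (g₁ + α_{e₁}(g₂), e₁ + e₂)`,
for a homomorphism `α` from `(ℤ/2ℤ, +)` to `Aut(ℤ/p²ℤ, +)`. -/
@[ext] structure SemidirectTrivial (p : ℕ)
    (α : ZMod 2 →+ AddAut (ZMod (p ^ 2))) where
  g : ZMod (p ^ 2)
  e : ZMod 2

namespace SemidirectTrivial

variable {p : ℕ} {α : ZMod 2 →+ AddAut (ZMod (p ^ 2))}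

instance : Add (SemidirectTrivial p α) := ⟨fun x y => ⟨x.g + y.g, y.e⟩⟩

instance : Mul (SemidirectTrivial p α) :=
  ⟨fun x y => ⟨x.g + α x.e y.g, x.e + y.e⟩⟩

instance : One (SemidirectTrivial p α) := ⟨⟨0, 0⟩⟩

instance : Inv (SemidirectTrivial p α) :=
  ⟨fun x => ⟨-(α (-x.e) x.g), -x.e⟩⟩

@[simp] theorem add_g (x y : SemidirectTrivial p α) : (x + y).g = x.g + y.g := rfl
@[simp] theorem add_e (x y : SemidirectTrivial p α) : (x + y).e = y.e := rfl
@[simp] theorem mul_g (x y : SemidirectTrivial p α) :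
    (x * y).g = x.g + α x.e y.g := rfl
@[simp] theorem mul_e (x y : SemidirectTrivial p α) : (x * y).e = x.e + y.e := rfl
@[simp] theorem one_g : (1 : SemidirectTrivial p α).g = 0 := rfl
@[simp] theorem one_e : (1 : SemidirectTrivial p α).e = 0 := rfl
@[simp] theorem inv_g (x : SemidirectTrivial p α) :
    x⁻¹.g = -(α (-x.e) x.g) := rfl
@[simp] theorem inv_e (x : SemidirectTrivial p α) : x⁻¹.e = -x.e := rfl

instance : LeftSemiBrace (SemidirectTrivial p α) where
  add_assoc x y z := by
    ext <;> simp [add_assoc]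
  mul_assoc x y z := by
    ext <;> simp [add_assoc]
  one_mul x := by
    ext <;> simp
  mul_one x := by
    ext <;> simp
  inv_mul_cancel x := by
    ext
    · simp only [mul_g, inv_g, inv_e, one_g, neg_add_cancel]
    · simp only [mul_e, inv_e, one_e, neg_add_cancel]
  mul_add_eq x y z := by
    have h : ∀ t, α x.e (α (-x.e) t) = t := by
      intro t
      rw [← AddAut.add_apply, ← map_add, add_neg_cancel, map_zero, AddAut.zero_apply]
    ext
    · simp only [mul_g, add_g, inv_g, map_add, map_neg]
      simp only [← map_neg, h]
      abel
    · simp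

instance : IsLeftCancelAdd (SemidirectTrivial p α) where
  add_left_cancel x y z h := by
    change x + y = x + z at h
    have hg : x.g + y.g = x.g + z.g := congrArg SemidirectTrivial.g h
    have he : y.e = z.e := by simpa only [add_e] using congrArg SemidirectTrivial.e h
    exact SemidirectTrivial.ext (add_left_cancel hg) he

end SemidirectTrivial

/-- The set `ℤ/p²ℤ × ℤ/2ℤ`, with
`(g₁, e₁) + (g₂, e₂) = (g₁ + g₂, e₂)` and
`(g₁, e₁) ∘ (g₂, e₂) = (g₁ + g₂, e₁ + e₂)`. -/
@[ext] structure DirectTrivial (p : ℕ) where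
  g : ZMod (p ^ 2)
  e : ZMod 2

namespace DirectTrivial

variable {p : ℕ}

instance : Add (DirectTrivial p) := ⟨fun x y => ⟨x.g + y.g, y.e⟩⟩
instance : Mul (DirectTrivial p) := ⟨fun x y => ⟨x.g + y.g, x.e + y.e⟩⟩
instance : One (DirectTrivial p) := ⟨⟨0, 0⟩⟩
instance : Inv (DirectTrivial p) := ⟨fun x => ⟨-x.g, -x.e⟩⟩

@[simp] theorem add_g (x y : DirectTrivial p) : (x + y).g = x.g + y.g := rfl
@[simp] theorem add_e (x y : DirectTrivial p) : (x + y).e = y.e := rfl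
@[simp] theorem mul_g (x y : DirectTrivial p) : (x * y).g = x.g + y.g := rfl
@[simp] theorem mul_e (x y : DirectTrivial p) : (x * y).e = x.e + y.e := rfl
@[simp] theorem one_g : (1 : DirectTrivial p).g = 0 := rfl
@[simp] theorem one_e : (1 : DirectTrivial p).e = 0 := rfl
@[simp] theorem inv_g (x : DirectTrivial p) : x⁻¹.g = -x.g := rfl
@[simp] theorem inv_e (x : DirectTrivial p) : x⁻¹.e = -x.e := rfl

instance : LeftSemiBrace (DirectTrivial p) where
  add_assoc x y z := by
    ext <;> simp [add_assoc]
  mul_assoc x y z := by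
    ext <;> simp [add_assoc]
  one_mul x := by
    ext <;> simp
  mul_one x := by
    ext <;> simp
  inv_mul_cancel x := by
    ext
    · simp only [mul_g, inv_g, one_g, neg_add_cancel]
    · simp only [mul_e, inv_e, one_e, neg_add_cancel]
  mul_add_eq x y z := by
    ext <;> simp [add_assoc]

instance : IsLeftCancelAdd (DirectTrivial p) where
  add_left_cancel x y z h := by
    change x + y = x + z at h
    have hg : x.g + y.g = x.g + z.g := congrArg DirectTrivial.g h
    have he : y.e = z.e := by simpa only [add_e] using congrArg DirectTrivial.e h
    exact DirectTrivial.ext (add_left_cancel hg) he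

end DirectTrivial

/-- The set `ℤ/p²ℤ × ℤ/2ℤ`, with
`(g₁, e₁) + (g₂, e₂) = (g₁ + g₂, e₂)` and
`(g₁, e₁) ∘ (g₂, e₂) = (g₁ + g₂ + p g₁ g₂, e₁ + e₂)`. -/
@[ext] structure DirectNontrivial (p : ℕ) where
  g : ZMod (p ^ 2)
  e : ZMod 2

namespace DirectNontrivial

variable {p : ℕ}

instance : Add (DirectNontrivial p) := ⟨fun x y => ⟨x.g + y.g, y.e⟩⟩
instance : Mul (DirectNontrivial p) :=
  ⟨fun x y => ⟨x.g + y.g + (p : ZMod (p ^ 2)) * x.g * y.g, x.e + y.e⟩⟩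
instance : One (DirectNontrivial p) := ⟨⟨0, 0⟩⟩
instance : Inv (DirectNontrivial p) :=
  ⟨fun x => ⟨-x.g + (p : ZMod (p ^ 2)) * x.g ^ 2, -x.e⟩⟩

@[simp] theorem add_g (x y : DirectNontrivial p) : (x + y).g = x.g + y.g := rfl
@[simp] theorem add_e (x y : DirectNontrivial p) : (x + y).e = y.e := rfl
@[simp] theorem mul_g (x y : DirectNontrivial p) :
    (x * y).g = x.g + y.g + (p : ZMod (p ^ 2)) * x.g * y.g := rfl
@[simp] theorem mul_e (x y : DirectNontrivial p) : (x * y).e = x.e + y.e := rfl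
@[simp] theorem one_g : (1 : DirectNontrivial p).g = 0 := rfl
@[simp] theorem one_e : (1 : DirectNontrivial p).e = 0 := rfl
@[simp] theorem inv_g (x : DirectNontrivial p) :
    x⁻¹.g = -x.g + (p : ZMod (p ^ 2)) * x.g ^ 2 := rfl
@[simp] theorem inv_e (x : DirectNontrivial p) : x⁻¹.e = -x.e := rfl

theorem p_sq_eq_zero (p : ℕ) : (p : ZMod (p ^ 2)) ^ 2 = 0 := by
  have h := ZMod.natCast_self (p ^ 2)
  rwa [Nat.cast_pow] at h

instance : LeftSemiBrace (DirectNontrivial p) where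
  add_assoc x y z := by
    ext <;> simp [add_assoc]
  mul_assoc x y z := by
    ext
    · simp only [mul_g]; ring
    · simp [add_assoc]
  one_mul x := by
    ext <;> simp
  mul_one x := by
    ext <;> simp
  inv_mul_cancel x := by
    ext
    · simp only [mul_g, inv_g, one_g]
      linear_combination x.g ^ 3 * p_sq_eq_zero p
    · simp only [mul_e, inv_e, one_e, neg_add_cancel]
  mul_add_eq x y z := by
    ext
    · simp only [mul_g, add_g, inv_g]
      linear_combination (-x.g ^ 3) * p_sq_eq_zero p
    · simp

instance : IsLeftCancelAdd (DirectNontrivial p) where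
  add_left_cancel x y z h := by
    change x + y = x + z at h
    have hg : x.g + y.g = x.g + z.g := congrArg DirectNontrivial.g h
    have he : y.e = z.e := by simpa only [add_e] using congrArg DirectNontrivial.e h
    exact DirectNontrivial.ext (add_left_cancel hg) he

end DirectNontrivial

/-!
Let `1` be the neutral element of `∘`. In a left cancellative left semi-brace `B`, every idempotent
of `+` is a left identity of `+`, and every element is uniquely `g + e` with `g ∈ G` and `e ∈ E`
(`LeftSemiBrace.bijective_add`). The set `G` is a skew brace under the two operations, of order
`p ^ 2` here, and `λ_g` preserves `E = {1, k}` and fixes `1`, so it fixes `k`; hence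
`g + k = g ∘ k`, and `k` is an involution of `(B, ∘)` whose conjugation `φ` is an automorphism of
the skew brace `G`. So `B` is determined by `G` and `φ`
(`LeftSemiBrace.exists_equiv_prod_zmod_two`).

The group `(G, +)` has order `p ^ 2`, so it is abelian. It is cyclic because `(G, ∘)` is: on a plane
over `𝔽_p` the map `L = λ_g` is unipotent,
`g ^ p = (1 + L + ⋯ + L ^ (p - 1)) g = (L - 1) ^ (p - 1) g`, and this vanishes since
`(L - 1) ^ 2 = 0` and `p > 2` (`isAddCyclic_of_isCyclic_of_card_eq_sq`). On `ℤ/p²ℤ` the operation is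
`x ∘ y = x + u(x) y` for a homomorphism `u` from `(G, ∘)` to the units congruent to `1` modulo `p`.
Computing the powers of `1` shows that `u` is trivial on multiples of `p`, and therefore
`u(x) = 1 + p v x` for a constant `v` (`exists_mul_formula`). If `p v ≠ 0`, scaling by `v` makes the
constant `1` (`exists_addEquiv_zmod_sq`).

The involution `φ` is multiplication by a square root of `1` in `ℤ/p²ℤ`, that is by `1` or `-1`, and
`-1` does not respect `x + y + p x y`. The three remaining combinations are the three models. The
third is multiplicatively a direct product through the truncated logarithm `x ↦ x - p x ^ 2 / 2`.
The first is the only one whose multiplication is not commutative, and the second differs from the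
third in that both operations agree on `G`.
-/

/-! ### Units and squares modulo `p ^ 2` -/

section ZModSq

variable {p : ℕ}

theorem natCast_eq_zero_zmod_sq_iff (n : ℕ) :
    (n : ZMod (p ^ 2)) = 0 ↔ p ^ 2 ∣ n :=
  ZMod.natCast_eq_zero_iff n (p ^ 2)

theorem natCast_prime_zmod_sq_ne_zero (hp : p.Prime) : (p : ZMod (p ^ 2)) ≠ 0 := by
  rw [Ne, natCast_eq_zero_zmod_sq_iff]
  intro h
  have := Nat.le_of_dvd hp.pos h
  nlinarith [hp.two_le]

theorem one_ne_neg_one_zmod_sq (hp2 : 2 < p) : (1 : ZMod (p ^ 2)) ≠ -1 := by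
  intro h
  have h2 : ((2 : ℕ) : ZMod (p ^ 2)) = 0 := by push_cast; linear_combination h
  rw [natCast_eq_zero_zmod_sq_iff] at h2
  have := Nat.le_of_dvd two_pos h2
  nlinarith

theorem isUnit_two_zmod_sq (hp : p.Prime) (hp2 : 2 < p) : IsUnit (2 : ZMod (p ^ 2)) := by
  have h : IsUnit ((2 : ℕ) : ZMod (p ^ 2)) := by
    rw [ZMod.isUnit_iff_coprime]
    exact Nat.Coprime.pow_right 2 ((Nat.coprime_primes Nat.prime_two hp).2 hp2.ne)
  exact_mod_cast h

theorem eq_one_or_eq_neg_one_of_sq_eq_one (hp : p.Prime) (hp2 : 2 < p) {u : ZMod (p ^ 2)}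
    (hu : u * u = 1) : u = 1 ∨ u = -1 := by
  obtain ⟨a, rfl⟩ := ZMod.intCast_surjective u
  have h1 : ((p : ℤ) ^ 2) ∣ (a - 1) * (a + 1) := by
    have : (((a - 1) * (a + 1) : ℤ) : ZMod (p ^ 2)) = 0 := by
      push_cast; linear_combination hu
    simpa using (ZMod.intCast_zmod_eq_zero_iff_dvd _ _).1 this
  have hpZ : Prime (p : ℤ) := Nat.prime_iff_prime_int.1 hp
  have hcast (b : ℤ) (hb : (p : ℤ) ^ 2 ∣ b) : (b : ZMod (p ^ 2)) = 0 :=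
    (ZMod.intCast_zmod_eq_zero_iff_dvd _ _).2 (by simpa using hb)
  -- An odd prime cannot divide both of the factors `a - 1` and `a + 1`, whose difference is `2`.
  by_cases h : (p : ℤ) ∣ a - 1
  · have h' : ¬ (p : ℤ) ∣ a + 1 := by
      intro h'
      have h3 : (p : ℤ) ∣ 2 := by simpa using dvd_sub h' h
      have := Int.le_of_dvd two_pos h3
      omega
    left
    have h4 := hcast _ (hpZ.pow_dvd_of_dvd_mul_right 2 h' h1)
    push_cast at h4
    linear_combination h4
  · right
    have h4 := hcast _ (hpZ.pow_dvd_of_dvd_mul_left 2 h h1)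
    push_cast at h4
    linear_combination h4

theorem exists_eq_mul_of_not_isUnit (hp : p.Prime) {v : ZMod (p ^ 2)} (hv : ¬ IsUnit v) :
    ∃ w, v = p * w := by
  have : NeZero p := ⟨hp.ne_zero⟩
  obtain ⟨n, rfl⟩ := ZMod.natCast_zmod_surjective v
  rw [ZMod.isUnit_iff_coprime] at hv
  have : p ∣ n := by
    by_contra h
    exact hv (((hp.coprime_iff_not_dvd.2 h).symm).pow_right 2)
  obtain ⟨m, rfl⟩ := this
  exact ⟨m, by push_cast; rfl⟩

/-- By Fermat's little theorem, `u ^ p ^ 2` is congruent to `u` modulo `p`. -/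
theorem exists_eq_one_add_of_pow_eq_one (hp : p.Prime) {u : ZMod (p ^ 2)}
    (hu : u ^ p ^ 2 = 1) : ∃ v, u = 1 + p * v := by
  have : NeZero p := ⟨hp.ne_zero⟩
  have : Fact p.Prime := ⟨hp⟩
  obtain ⟨w, hw⟩ : ∃ w, u - 1 = p * w := by
    refine exists_eq_mul_of_not_isUnit hp fun hunit => ?_
    have hd : p ∣ p ^ 2 := dvd_pow_self p two_ne_zero
    have h1 := hunit.map (ZMod.castHom hd (ZMod p))
    have h2 := congrArg (ZMod.castHom hd (ZMod p)) hu
    rw [map_pow, ZMod.pow_card_pow, map_one] at h2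
    rw [map_sub, h2, map_one, sub_self] at h1
    exact not_isUnit_zero h1
  exact ⟨w, by linear_combination hw⟩

theorem addMonoidHom_apply_zmod {n : ℕ} (f : ZMod n →+ ZMod n) (x : ZMod n) :
    f x = f 1 * x := by
  have h := (f.toZModLinearMap n).map_smul x 1
  simpa [mul_comm] using h

end ZModSq

/-! ### Braces with cyclic additive group of order `p ^ 2` -/

section CyclicAdditive

variable {p : ℕ} {M : Type*} [Group M] (f : M ≃ ZMod (p ^ 2)) (u : M → ZMod (p ^ 2))

/-- The multiplication `x ∘ y = x + λ_x(y)` of a brace on `ℤ/p²ℤ`, where `λ_x` is multiplication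
by `u x`, has `u x = 1 + p v x` for some fixed `v`. Each `u x` is `1` modulo `p`; the powers
of the element `1` are `1 ^ n = n + p v (n choose 2)`, so `1 ^ p = p` because `p` is odd. Hence
`u` is trivial on the multiples of `p`, and every element is a power of `1` times such a
multiple. -/
theorem exists_mul_formula (hp : p.Prime) (hp2 : 2 < p)
    (hmul : ∀ a b, f (a * b) = f a + u a * f b) (hu : ∀ a b, u (a * b) = u a * u b) :
    ∃ v : ZMod (p ^ 2), ∀ a b, f (a * b) = f a + f b + (p : ZMod (p ^ 2)) * v * f a * f b := by
  have : NeZero p := ⟨hp.ne_zero⟩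
  have hpp : (p : ZMod (p ^ 2)) * p = 0 := by
    rw [← Nat.cast_mul, natCast_eq_zero_zmod_sq_iff, sq]
  have hf1 : f 1 = 0 := by
    have h := hmul 1 (f.symm 0)
    simpa using h.symm
  have hu1 : u 1 = 1 := by
    have h := hmul 1 (f.symm 1)
    simpa [hf1] using h.symm
  have hupow (a : M) (n : ℕ) : u (a ^ n) = u a ^ n := by
    induction n with
    | zero => simp [hu1]
    | succ n ih => rw [pow_succ a n, hu, ih, pow_succ (u a) n]
  have hcard : Nat.card M = p ^ 2 := by rw [Nat.card_congr f, Nat.card_zmod]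
  have hpow (a : M) : a ^ p ^ 2 = 1 := hcard ▸ pow_card_eq_one'
  obtain ⟨v, hv⟩ := exists_eq_one_add_of_pow_eq_one hp (u := u (f.symm 1)) (by
    rw [← hupow, hpow, hu1])
  set g := f.symm 1 with hg
  have hfg : f g = 1 := by simp [hg]
  have hug (n : ℕ) : u (g ^ n) = 1 + n * (p * v) := by
    induction n with
    | zero => simp [hu1]
    | succ n ih =>
      rw [pow_succ g n, hu, ih, hv]
      push_cast
      linear_combination (n : ZMod (p ^ 2)) * v * v * hpp
  have hfgn (n : ℕ) : f (g ^ n) = n + p * v * (n.choose 2 : ℕ) := by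
    induction n with
    | zero => simp [hf1]
    | succ n ih =>
      rw [pow_succ g n, hmul, ih, hug, hfg, Nat.choose_succ_succ' n 1, Nat.choose_one_right]
      push_cast
      ring
  have hq : f (g ^ p) = p := by
    obtain ⟨c, hc⟩ := hp.dvd_choose_self two_ne_zero hp2
    rw [hfgn, hc]
    push_cast
    linear_combination v * (c : ZMod (p ^ 2)) * hpp
  have huq : u (g ^ p) = 1 := by
    rw [hug]
    linear_combination v * hpp
  have huqk (k : ℕ) : u ((g ^ p) ^ k) = 1 := by rw [hupow, huq, one_pow]
  have hqk (k : ℕ) : f ((g ^ p) ^ k) = k * p := by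
    induction k with
    | zero => simp [hf1]
    | succ k ih =>
      rw [pow_succ (g ^ p) k, hmul, ih, huqk, hq]
      push_cast
      ring
  have hua (a : M) : u a = 1 + p * v * f a := by
    -- `f (g ^ n)` agrees with `f a` up to a multiple of `p`, which a power of `g ^ p` corrects.
    set n := (f a).val with hn
    have hna : (n : ZMod (p ^ 2)) = f a := by simp [hn]
    obtain ⟨k, hk⟩ := ZMod.natCast_zmod_surjective (-(v * (n.choose 2 : ℕ)) : ZMod (p ^ 2))
    have ha : a = g ^ n * (g ^ p) ^ k := by
      apply f.injective
      rw [hmul, hfgn, hug, hqk, hk, hna]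
      linear_combination f a * v * v * ((n.choose 2 : ℕ) : ZMod (p ^ 2)) * hpp
    calc u a = u (g ^ n) := by
          rw [ha, hu, huqk, mul_one]
      _ = 1 + p * v * f a := by rw [hug, hna]; ring
  exact ⟨v, fun a b => by rw [hmul, hua]; ring⟩

end CyclicAdditive

/-! ### Braces with cyclic multiplicative group of order `p ^ 2` -/

section CyclicMultiplicative

variable {p : ℕ} {A : Type*}

/-- An endomorphism `L` of a plane over `𝔽_p` of order a power of `p` is unipotent, so
`(L - 1) ^ 2 = 0`, while `1 + L + ⋯ + L ^ (p - 1) = (L - 1) ^ (p - 1)` in characteristic `p`. -/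
theorem geom_sum_eq_zero_of_finrank_eq_two [Fact p.Prime] (hp2 : 2 < p) {V : Type*}
    [AddCommGroup V] [Module (ZMod p) V] (hfin : Module.finrank (ZMod p) V = 2)
    (L : Module.End (ZMod p) V) {n : ℕ} (hL : L ^ p ^ n = 1) :
    ∑ i ∈ Finset.range p, L ^ i = 0 := by
  have : Module.Finite (ZMod p) V := Module.finite_of_finrank_pos (by omega)
  have hp : p.Prime := Fact.out
  have h1 : (L - 1) ^ p ^ n = 0 := by
    have h := congrArg (Polynomial.aeval L)
      (sub_pow_char_pow (R := Polynomial (ZMod p)) (p := p) (n := n) Polynomial.X 1)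
    simpa [hL] using h
  have hnil : (L - 1) ^ 2 = 0 := by
    have h := LinearMap.aeval_self_charpoly (L - 1)
    rwa [(LinearMap.isNilpotent_iff_charpoly (L - 1)).1 ⟨_, h1⟩, hfin, map_pow,
      Polynomial.aeval_X] at h
  have hsum := Polynomial.cyclotomic_mul_prime_eq_pow_of_not_dvd (ZMod p) (p := p) (n := 1)
    hp.not_dvd_one
  rw [one_mul, Polynomial.cyclotomic_one, Polynomial.cyclotomic_prime] at hsum
  have h := congrArg (Polynomial.aeval L) hsum
  rw [map_sum, show p - 1 = 2 + (p - 3) by omega, pow_add, map_mul] at h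
  simpa [hnil] using h

section Brace

variable [AddCommGroup A] [Group A] (lam : A → A →+ A)

/-- If the additive group of a brace is a plane over `𝔽_p`, then, with `L = λ_g`,
`g ^ p = (1 + L + ⋯ + L ^ (p - 1)) g = 0`, and `0` is also the neutral element of `∘`. -/
theorem pow_prime_eq_one_of_zmodModule [Fact p.Prime] [Module (ZMod p) A] (hp2 : 2 < p)
    (hcard : Nat.card A = p ^ 2) (hmul : ∀ a b, a * b = a + lam a b)
    (hlam : ∀ a b c, lam (a * b) c = lam a (lam b c)) (g : A) : g ^ p = 1 := by
  have hp : p.Prime := Fact.out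
  have : Finite A := Nat.finite_of_card_ne_zero (by rw [hcard]; exact pow_ne_zero 2 hp.ne_zero)
  have h10 : (1 : A) = 0 := by simpa using (hmul 1 0).symm
  have hlam1 (b : A) : lam 1 b = b := by
    have h := hmul 1 b
    rw [one_mul, h10, zero_add] at h
    rw [h10]; exact h.symm
  have hfin : Module.finrank (ZMod p) A = 2 := by
    have h := Module.natCard_eq_pow_finrank (K := ZMod p) (V := A)
    rw [hcard, Nat.card_zmod] at h
    exact (Nat.pow_right_injective hp.two_le h).symm
  let L : Module.End (ZMod p) A := (lam g).toZModLinearMap p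
  have hLpow (n : ℕ) (b : A) : (L ^ n) b = lam (g ^ n) b := by
    induction n generalizing b with
    | zero => simp [hlam1]
    | succ n ih =>
      rw [pow_succ, Module.End.mul_apply, ih, pow_succ, hlam]
      rfl
  have hgpow (n : ℕ) : g ^ n = (∑ i ∈ Finset.range n, L ^ i) g := by
    induction n with
    | zero => simp [h10]
    | succ n ih =>
      rw [pow_succ, hmul, ← hLpow, Finset.sum_range_succ, LinearMap.add_apply, ← ih]
  have hLone : L ^ p ^ 2 = 1 := by
    ext b
    rw [hLpow, ← hcard, pow_card_eq_one', hlam1, Module.End.one_apply]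
  rw [hgpow, geom_sum_eq_zero_of_finrank_eq_two hp2 hfin L hLone, h10]
  rfl

/-- If the multiplicative group of a brace of order `p ^ 2` is cyclic, then so is the additive
group: otherwise the latter is a plane over `𝔽_p`, and multiplicative orders divide `p`. -/
theorem isAddCyclic_of_isCyclic_of_card_eq_sq [IsCyclic A]
    (hp : p.Prime) (hp2 : 2 < p) (hcard : Nat.card A = p ^ 2)
    (hmul : ∀ a b, a * b = a + lam a b) (hlam : ∀ a b c, lam (a * b) c = lam a (lam b c)) :
    IsAddCyclic A := by
  have : Fact p.Prime := ⟨hp⟩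
  have : Finite A := Nat.finite_of_card_ne_zero (by rw [hcard]; exact pow_ne_zero 2 hp.ne_zero)
  by_contra hcyc
  have hexp : ∀ a : A, p • a = 0 := by
    obtain ⟨k, hk, he⟩ := (Nat.dvd_prime_pow hp).1
      (hcard ▸ AddGroup.exponent_dvd_nat_card : AddMonoid.exponent A ∣ p ^ 2)
    have hk2 : k ≠ 2 := by
      rintro rfl
      exact hcyc (IsAddCyclic.iff_exponent_eq_card.2 (he.trans hcard.symm))
    intro a
    refine AddMonoid.exponent_dvd_iff_forall_nsmul_eq_zero.1 ?_ a
    rw [he]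
    exact (pow_dvd_pow p (by omega : k ≤ 1)).trans (pow_one p).dvd
  let : Module (ZMod p) A := AddCommGroup.zmodModule hexp
  obtain ⟨g, hg⟩ := IsCyclic.exists_generator (α := A)
  have hord : orderOf g = p ^ 2 := by rw [orderOf_eq_card_of_forall_mem_zpowers hg, hcard]
  have hdvd := Nat.le_of_dvd hp.pos (hord ▸ orderOf_dvd_of_pow_eq_one
    (pow_prime_eq_one_of_zmodModule lam hp2 hcard hmul hlam g))
  nlinarith

end Brace

/-- A brace of order `p ^ 2` with cyclic multiplicative group is isomorphic to `ℤ/p²ℤ` with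
`x ∘ y = x + y` or with `x ∘ y = x + y + p x y`. -/
theorem exists_addEquiv_zmod_sq [AddGroup A] [Group A] [IsCyclic A]
    (hp : p.Prime) (hp2 : 2 < p) (hcard : Nat.card A = p ^ 2) (lam : A → A →+ A)
    (hmul : ∀ a b, a * b = a + lam a b) (hlam : ∀ a b c, lam (a * b) c = lam a (lam b c)) :
    ∃ f : A ≃+ ZMod (p ^ 2), (∀ a b, f (a * b) = f a + f b) ∨
      ∀ a b, f (a * b) = f a + f b + p * f a * f b := by
  have : Fact p.Prime := ⟨hp⟩
  have hcomm := (IsPGroup.isMulCommutative_of_card_eq_prime_sq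
    (G := Multiplicative A) (p := p) hcard).is_comm.comm
  let : AddCommGroup A := { ‹AddGroup A› with add_comm := fun a b => hcomm a b }
  have hcyc := isAddCyclic_of_isCyclic_of_card_eq_sq lam hp hp2 hcard hmul hlam
  have f : A ≃+ ZMod (p ^ 2) := hcard ▸ (zmodAddCyclicAddEquiv hcyc).symm
  have hlf (a b : A) : f (lam a b) = f (lam a (f.symm 1)) * f b := by
    have h := addMonoidHom_apply_zmod
      ((f.toAddMonoidHom.comp (lam a)).comp f.symm.toAddMonoidHom) (f b)
    simpa using h
  obtain ⟨v, hv⟩ := exists_mul_formula f.toEquiv (fun a => f (lam a (f.symm 1))) hp hp2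
    (fun a b => (congrArg f (hmul a b)).trans ((map_add f _ _).trans (by rw [hlf a b]; rfl)))
    (fun a b => (congrArg f (hlam a b _)).trans (hlf a _))
  replace hv (a b : A) : f (a * b) = f a + f b + (p : ZMod (p ^ 2)) * v * f a * f b := hv a b
  by_cases hunit : IsUnit v
  · -- Rescaling by the unit `v` turns the coefficient `p * v` into `p`.
    obtain ⟨w, rfl⟩ := hunit
    refine ⟨f.trans (AddAut.mulLeft w).toAdd, Or.inr fun a b => ?_⟩
    change (w : ZMod (p ^ 2)) * f (a * b) =
      w * f a + w * f b + p * (w * f a) * (w * f b)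
    rw [hv]
    ring
  · obtain ⟨w, rfl⟩ := exists_eq_mul_of_not_isUnit hp hunit
    have hpp : (p : ZMod (p ^ 2)) * p = 0 := by
      rw [← Nat.cast_mul, natCast_eq_zero_zmod_sq_iff, sq]
    exact ⟨f, Or.inl fun a b => by rw [hv]; linear_combination w * f a * f b * hpp⟩

end CyclicMultiplicative

/-! ### The decomposition `B = G + E` -/

namespace LeftSemiBrace

section Decomposition

variable {B : Type*} [LeftSemiBrace B]

theorem lam_add (a b c : B) : lam a (b + c) = lam a b + lam a c := by
  unfold lam
  rw [← add_assoc, mul_add_eq]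

theorem lam_mem_E (a : B) {e : B} (he : e ∈ E B) : lam a e ∈ E B := by
  change lam a e + lam a e = lam a e
  rw [← lam_add]
  exact congrArg (lam a) he

variable [IsLeftCancelAdd B]

theorem lam_injective (a : B) : Function.Injective (lam a) := fun _ _ h =>
  add_left_cancel (mul_left_cancel h)

theorem lam_one_of_mem_G {a : B} (ha : a ∈ G B) : lam a 1 = 1 :=
  (exists_add_one_iff a).1 ha

theorem mem_G_iff_add_one {a : B} : a ∈ G B ↔ a + 1 = a := by
  refine ⟨?_, fun h => ⟨a, h⟩⟩
  rintro ⟨b, rfl⟩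
  rw [add_assoc, one_add_eq]

theorem add_one_mem_G (b : B) : b + 1 ∈ G B := ⟨b, rfl⟩

theorem one_mem_E : (1 : B) ∈ E B := one_add_eq 1

theorem add_eq_of_mem_E {e : B} (he : e ∈ E B) (c : B) : e + c = c := by
  have he' : e + e = e := he
  apply add_left_cancel (a := e)
  rw [← add_assoc, he']

theorem mul_eq_lam_of_mem_E {e : B} (he : e ∈ E B) (c : B) : e * c = lam e c := by
  rw [← add_lam, add_eq_of_mem_E he]

theorem mul_add_of_mem_E {e : B} (he : e ∈ E B) (b c : B) : e * (b + c) = e * b + e * c := by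
  simp only [mul_eq_lam_of_mem_E he, lam_add]

theorem mul_mem_E {e f : B} (he : e ∈ E B) (hf : f ∈ E B) : e * f ∈ E B := by
  rw [mul_eq_lam_of_mem_E he]
  exact lam_mem_E e hf

instance : Add (G B) :=
  ⟨fun a b => ⟨a + b, mem_G_iff_add_one.2 (by rw [add_assoc, mem_G_iff_add_one.1 b.2])⟩⟩

instance : Zero (G B) := ⟨1⟩

/-- The additive inverse of `a` is `λ_a(a⁻)`, because `a + λ_a(a⁻) = a ∘ a⁻`. -/
instance : Neg (G B) :=
  ⟨fun a => ⟨lam (a : B) (a : B)⁻¹, mem_G_iff_add_one.2 (by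
    conv_lhs => rw [← lam_one_of_mem_G a.2, ← lam_add]
    rw [mem_G_iff_add_one.1 ((G B).inv_mem a.2)])⟩⟩

theorem coe_add (a b : G B) : ((a + b : G B) : B) = a + b := rfl

theorem coe_zero : ((0 : G B) : B) = 1 := rfl

/-- The additive group of the skew brace `G`; its neutral element is that of `∘`. -/
instance : AddGroup (G B) :=
  AddGroup.ofRightAxioms
    (fun a b c => Subtype.ext (add_assoc (a : B) b c))
    (fun a => Subtype.ext (mem_G_iff_add_one.1 a.2))
    (fun a => Subtype.ext ((add_lam (a : B) (a : B)⁻¹).trans (mul_inv_cancel (a : B))))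

/-- The map `λ_a` for `a ∈ G`, as an endomorphism of `(G, +)`. -/
def lamG (a : G B) : G B →+ G B :=
  AddMonoidHom.mk' (fun b => ⟨lam (a : B) b, mem_G_iff_add_one.2 (by
    conv_lhs => rw [← lam_one_of_mem_G a.2, ← lam_add]
    rw [mem_G_iff_add_one.1 b.2])⟩)
    fun b c => Subtype.ext (lam_add (a : B) b c)

theorem mul_eq_add_lamG (a b : G B) : a * b = a + lamG a b :=
  Subtype.ext (add_lam (a : B) b).symm

theorem lamG_mul (a b c : G B) : lamG (a * b) c = lamG a (lamG b c) :=
  Subtype.ext (lam_mul (a : B) b c)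

theorem bijective_add : Function.Bijective fun x : G B × E B => (x.1 : B) + x.2 := by
  constructor
  · rintro ⟨g, e⟩ ⟨h, f⟩ heq
    replace heq : (g : B) + e = h + f := heq
    have hgh : (g : B) = h := by
      have := congrArg (· + (1 : B)) heq
      simpa only [add_assoc, add_eq_of_mem_E e.2, add_eq_of_mem_E f.2,
        mem_G_iff_add_one.1 g.2, mem_G_iff_add_one.1 h.2] using this
    rw [hgh] at heq
    exact Prod.ext (Subtype.ext hgh) (Subtype.ext (add_left_cancel heq))
  · intro b
    let g : G B := ⟨b + 1, add_one_mem_G b⟩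
    have hg : (g : B) + ((-g : G B) + b) = b := by
      rw [← add_assoc, ← coe_add, add_neg_cancel, coe_zero, one_add_eq]
    have hb (x : B) : b + x = g + x := by
      change b + x = b + 1 + x
      rw [add_assoc, one_add_eq]
    refine ⟨(g, ⟨(-g : G B) + b, ?_⟩), hg⟩
    change ((-g : G B) : B) + b + ((-g : G B) + b) = (-g : G B) + b
    rw [add_assoc, hb, hg]

theorem card_eq_card_G_mul_card_E : Nat.card B = Nat.card (G B) * Nat.card (E B) := by
  rw [← Nat.card_prod, Nat.card_congr (Equiv.ofBijective _ bijective_add)]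

end Decomposition

/-! ### Left semi-braces with two idempotents -/

section TwoIdempotents

variable {B : Type*} [LeftSemiBrace B] [IsLeftCancelAdd B]

theorem exists_E_eq_pair (hE : Nat.card (E B) = 2) :
    ∃ k : B, k ≠ 1 ∧ E B = {1, k} := by
  obtain ⟨x, y, hxy, h⟩ := Set.ncard_eq_two.1 hE
  have h1 : (1 : B) ∈ E B := one_mem_E
  rw [h] at h1
  rcases h1 with rfl | h1
  · exact ⟨y, hxy.symm, h⟩
  · rw [Set.mem_singleton_iff] at h1
    subst h1
    exact ⟨x, hxy, h.trans (Set.pair_comm _ _)⟩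

/-- With two idempotents `1` and `k`, the left semi-brace is a semidirect product of `G` and
`ℤ/2ℤ`: writing `(g, i)` for `g ∘ k ^ i = g + k ^ i`, the group `ℤ/2ℤ` acts on the skew brace `G`
through the involution `φ(g) = k ∘ g ∘ k⁻ = k ∘ g + 1`. -/
theorem exists_equiv_prod_zmod_two (hE : Nat.card (E B) = 2) :
    ∃ (Φ : G B × ZMod 2 ≃ B) (φ : G B →+ G B),
      (∀ g h, φ (g * h) = φ g * φ h) ∧ (∀ g, φ (φ g) = g) ∧
      (∀ g h i j, Φ (g, i) + Φ (h, j) = Φ (g + h, j)) ∧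
      ∀ g h i j, Φ (g, i) * Φ (h, j) = Φ (g * (if i = 0 then h else φ h), i + j) := by
  obtain ⟨k, hk1, hEk⟩ := exists_E_eq_pair hE
  have hk : k ∈ E B := by simp [hEk]
  have hkk : k * k = 1 := by
    have h := mul_mem_E hk hk
    rw [hEk] at h
    rcases h with h | h
    · exact h
    · exact absurd (mul_eq_right.1 h) hk1
  have hgk (g : G B) : (g : B) + k = g * k := by
    have h := lam_mem_E (g : B) hk
    rw [hEk] at h
    rcases h with h | h
    · exact absurd (lam_injective (g : B) (h.trans (lam_one_of_mem_G g.2).symm)) hk1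
    · rw [← add_lam, Set.mem_singleton_iff.1 h]
  let φ : G B →+ G B := AddMonoidHom.mk' (fun g => ⟨k * g + 1, add_one_mem_G _⟩) fun g h =>
    Subtype.ext (by
      simp only [coe_add, mul_add_of_mem_E hk, add_assoc, one_add_eq])
  have hφ (g : G B) : k * g = φ g * k := by
    have h1 : k * (g : B) = k * g + k := by
      conv_lhs => rw [← mem_G_iff_add_one.1 g.2, mul_add_of_mem_E hk, mul_one]
    rw [← hgk]
    change k * (g : B) = k * g + 1 + k
    rw [add_assoc, one_add_eq, ← h1]
  let s : ZMod 2 → B := fun i => if i = 0 then 1 else k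
  have hs0 : s 0 = 1 := if_pos rfl
  have hs1 : s 1 = k := if_neg one_ne_zero
  have hz : ∀ i : ZMod 2, i = 0 ∨ i = 1 := by decide
  have hsE (i : ZMod 2) : s i ∈ E B := by
    rcases hz i with rfl | rfl
    · rw [hs0]; exact one_mem_E
    · rwa [hs1]
  have hsg (g : G B) (i : ZMod 2) : (g : B) + s i = g * s i := by
    rcases hz i with rfl | rfl
    · rw [hs0, mem_G_iff_add_one.1 g.2, mul_one]
    · rw [hs1, hgk]
  have hsmul (i j : ZMod 2) : s i * s j = s (i + j) := by
    rcases hz i with rfl | rfl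
    · rw [hs0, one_mul, zero_add]
    · rcases hz j with rfl | rfl
      · rw [hs0, mul_one, add_zero]
      · rw [hs1, hkk, show (1 + 1 : ZMod 2) = 0 by decide, hs0]
  have hsφ (i : ZMod 2) (h : G B) : s i * h = (if i = 0 then h else φ h : G B) * s i := by
    rcases hz i with rfl | rfl
    · simp [hs0]
    · rw [hs1, if_neg one_ne_zero, hφ]
  have hsbij : Function.Bijective fun i => (⟨s i, hsE i⟩ : E B) := by
    constructor
    · intro i j hij
      replace hij : s i = s j := congrArg Subtype.val hij
      rcases hz i with rfl | rfl <;> rcases hz j with rfl | rfl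
      · rfl
      · exact absurd (hs1 ▸ hs0 ▸ hij).symm hk1
      · exact absurd (hs1 ▸ hs0 ▸ hij) hk1
      · rfl
    · rintro ⟨e, he⟩
      have he' := he
      rw [hEk] at he'
      rcases he' with rfl | he'
      · exact ⟨0, Subtype.ext hs0⟩
      · exact ⟨1, Subtype.ext (hs1.trans (Set.mem_singleton_iff.1 he').symm)⟩
  let Φ : G B × ZMod 2 ≃ B :=
    ((Equiv.refl _).prodCongr (Equiv.ofBijective _ hsbij)).trans
      (Equiv.ofBijective _ bijective_add)
  have hΦ (g : G B) (i : ZMod 2) : Φ (g, i) = g + s i := rfl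
  refine ⟨Φ, φ, fun g h => ?_, fun g => ?_, fun g h i j => ?_, fun g h i j => ?_⟩
  · apply Subtype.ext
    apply mul_right_cancel (b := k)
    rw [← hφ, Subgroup.coe_mul, Subgroup.coe_mul, ← mul_assoc, hφ, mul_assoc, hφ, mul_assoc]
  · apply Subtype.ext
    apply mul_right_cancel (b := k)
    rw [← hφ]
    apply mul_right_cancel (b := k)
    rw [mul_assoc, ← hφ, ← mul_assoc, mul_assoc (g : B), hkk, one_mul, mul_one]
  · rw [hΦ, hΦ, hΦ, coe_add, add_assoc, add_assoc, add_eq_of_mem_E (hsE i)]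
  · rw [hΦ, hΦ, hΦ, hsg, hsg, hsg, ← hsmul, Subgroup.coe_mul, mul_assoc, ← mul_assoc (s i), hsφ]
    simp only [mul_assoc]

end TwoIdempotents

end LeftSemiBrace

/-! ### Involutions of `ℤ/p²ℤ` -/

section Involution

variable {p : ℕ}

/-- Inversion is the only automorphism of order two of `ℤ/p²ℤ`. -/
theorem apply_one_eq_neg_of_injective (hp : p.Prime) (hp2 : 2 < p)
    {α : ZMod 2 →+ AddAut (ZMod (p ^ 2))} (hα : Function.Injective α) (x : ZMod (p ^ 2)) :
    α 1 x = -x := by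
  have hmul (y : ZMod (p ^ 2)) : α 1 y = α 1 1 * y :=
    addMonoidHom_apply_zmod (AddEquiv.toAddMonoidHom (α 1)) y
  have hinv : α 1 (α 1 1) = 1 := by
    rw [← AddAut.add_apply, ← map_add, show (1 + 1 : ZMod 2) = 0 by decide, map_zero,
      AddAut.zero_apply]
  rw [hmul] at hinv
  rcases eq_one_or_eq_neg_one_of_sq_eq_one hp hp2 hinv with h | h
  · have h0 : α 1 = α 0 := by
      ext y
      rw [hmul, h, one_mul, map_zero, AddAut.zero_apply]
    exact absurd (hα h0) (by decide)
  · rw [hmul, h, neg_one_mul]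

theorem existsUnique_injective_hom (hp : p.Prime) (hp2 : 2 < p) :
    ∃! α : ZMod 2 →+ AddAut (ZMod (p ^ 2)), Function.Injective α := by
  have hneg : AddEquiv.neg (ZMod (p ^ 2)) ≠ (0 : AddAut (ZMod (p ^ 2))) := fun h =>
    one_ne_neg_one_zmod_sq hp2 (DFunLike.congr_fun h 1).symm
  have hneg2 : (AddEquiv.neg (ZMod (p ^ 2)) + AddEquiv.neg (ZMod (p ^ 2)) :
      AddAut (ZMod (p ^ 2))) = 0 := by
    ext y
    exact neg_neg y
  have hz : ∀ i : ZMod 2, i = 0 ∨ i = 1 := by decide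
  let α : ZMod 2 →+ AddAut (ZMod (p ^ 2)) := AddMonoidHom.mk'
    (fun i => if i = 0 then 0 else AddEquiv.neg _) fun i j => by
      rcases hz i with rfl | rfl <;> rcases hz j with rfl | rfl
      · simp
      · simp
      · simp
      · rw [if_pos (by decide), if_neg (by decide), hneg2]
  have hα : Function.Injective α := by
    refine (injective_iff_map_eq_zero α).2 fun i hi => ?_
    rcases hz i with rfl | rfl
    · rfl
    · exact absurd hi hneg
  refine ⟨α, hα, fun β hβ => ?_⟩
  ext i y
  rcases hz i with rfl | rfl
  · rw [map_zero, map_zero]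
  · rw [apply_one_eq_neg_of_injective hp hp2 hα, apply_one_eq_neg_of_injective hp hp2 hβ]

end Involution

/-! ### The three models -/

namespace SemidirectTrivial

variable {p : ℕ} {α : ZMod 2 →+ AddAut (ZMod (p ^ 2))}

/-- The pairs underlying the model. -/
def equivProd (p : ℕ) (α : ZMod 2 →+ AddAut (ZMod (p ^ 2))) :
    ZMod (p ^ 2) × ZMod 2 ≃ SemidirectTrivial p α :=
  ⟨fun x => ⟨x.1, x.2⟩, fun x => (x.g, x.e), fun _ => rfl, fun _ => rfl⟩

theorem E_eq : LeftSemiBrace.E (SemidirectTrivial p α) = {x | x.g = 0} := by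
  ext x
  simp [LeftSemiBrace.E, SemidirectTrivial.ext_iff]

theorem coe_G_eq :
    (LeftSemiBrace.G (SemidirectTrivial p α) : Set (SemidirectTrivial p α)) = {x | x.e = 0} := by
  ext x
  rw [SetLike.mem_coe, LeftSemiBrace.mem_G_iff_add_one]
  simp [SemidirectTrivial.ext_iff, eq_comm]

theorem isCyclic_G : IsCyclic (LeftSemiBrace.G (SemidirectTrivial p α)) := by
  have he (x : LeftSemiBrace.G (SemidirectTrivial p α)) : x.1.e = 0 := coe_G_eq.subset x.2
  refine isCyclic_of_injective (G' := Multiplicative (ZMod (p ^ 2)))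
    (MonoidHom.mk' (fun x => Multiplicative.ofAdd x.1.g) fun x y => ?_) fun x y h => ?_
  · rw [Subgroup.coe_mul, mul_g, he, map_zero, AddAut.zero_apply, ofAdd_add]
  · exact Subtype.ext (SemidirectTrivial.ext (Multiplicative.ofAdd.injective h)
      ((he x).trans (he y).symm))

/-- The multiplicative group of the model is the semidirect product along `α`. -/
def mulEquivSemidirectProduct : SemidirectTrivial p α ≃*
    Multiplicative (ZMod (p ^ 2)) ⋊[(MulAutMultiplicative
      (ZMod (p ^ 2))).symm.toMonoidHom.comp (AddMonoidHom.toMultiplicative α)]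
        Multiplicative (ZMod 2) where
  toFun x := ⟨Multiplicative.ofAdd x.g, Multiplicative.ofAdd x.e⟩
  invFun x := ⟨x.left.toAdd, x.right.toAdd⟩
  left_inv _ := rfl
  right_inv _ := rfl
  map_mul' _ _ := rfl

end SemidirectTrivial

namespace DirectTrivial

variable {p : ℕ}

/-- The pairs underlying the model. -/
def equivProd (p : ℕ) : ZMod (p ^ 2) × ZMod 2 ≃ DirectTrivial p :=
  ⟨fun x => ⟨x.1, x.2⟩, fun x => (x.g, x.e), fun _ => rfl, fun _ => rfl⟩

theorem E_eq : LeftSemiBrace.E (DirectTrivial p) = {x | x.g = 0} := by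
  ext x
  simp [LeftSemiBrace.E, DirectTrivial.ext_iff]

theorem coe_G_eq : (LeftSemiBrace.G (DirectTrivial p) : Set (DirectTrivial p)) = {x | x.e = 0} := by
  ext x
  rw [SetLike.mem_coe, LeftSemiBrace.mem_G_iff_add_one]
  simp [DirectTrivial.ext_iff, eq_comm]

/-- The multiplicative group of the model is the direct product. -/
def mulEquivProd :
    DirectTrivial p ≃* Multiplicative (ZMod (p ^ 2)) × Multiplicative (ZMod 2) where
  toFun x := (Multiplicative.ofAdd x.g, Multiplicative.ofAdd x.e)
  invFun x := ⟨x.1.toAdd, x.2.toAdd⟩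
  left_inv _ := rfl
  right_inv _ := rfl
  map_mul' _ _ := rfl

theorem isCyclic_G : IsCyclic (LeftSemiBrace.G (DirectTrivial p)) := by
  have he (x : LeftSemiBrace.G (DirectTrivial p)) : x.1.e = 0 := coe_G_eq.subset x.2
  refine isCyclic_of_injective (((MonoidHom.fst _ _).comp mulEquivProd.toMonoidHom).comp
    (LeftSemiBrace.G (DirectTrivial p)).subtype) fun x y h => ?_
  exact Subtype.ext (DirectTrivial.ext (Multiplicative.ofAdd.injective h)
      ((he x).trans (he y).symm))

end DirectTrivial

namespace DirectNontrivial

variable {p : ℕ}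

/-- The pairs underlying the model. -/
def equivProd (p : ℕ) : ZMod (p ^ 2) × ZMod 2 ≃ DirectNontrivial p :=
  ⟨fun x => ⟨x.1, x.2⟩, fun x => (x.g, x.e), fun _ => rfl, fun _ => rfl⟩

theorem E_eq : LeftSemiBrace.E (DirectNontrivial p) = {x | x.g = 0} := by
  ext x
  simp [LeftSemiBrace.E, DirectNontrivial.ext_iff]

theorem coe_G_eq :
    (LeftSemiBrace.G (DirectNontrivial p) : Set (DirectNontrivial p)) = {x | x.e = 0} := by
  ext x
  rw [SetLike.mem_coe, LeftSemiBrace.mem_G_iff_add_one]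
  simp [DirectNontrivial.ext_iff, eq_comm]

/-- With `c = 1 / 2`, the logarithm `x ↦ x - c p x ^ 2` turns the operation `x + y + p x y` into
addition; its inverse is `x ↦ x + c p x ^ 2`. -/
def mulEquivProd (c : ZMod (p ^ 2)) (hc : c * 2 = 1) :
    DirectNontrivial p ≃* Multiplicative (ZMod (p ^ 2)) × Multiplicative (ZMod 2) where
  toFun x := (Multiplicative.ofAdd (x.g - c * p * x.g ^ 2), Multiplicative.ofAdd x.e)
  invFun x := ⟨x.1.toAdd + c * p * x.1.toAdd ^ 2, x.2.toAdd⟩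
  left_inv x := by
    refine DirectNontrivial.ext ?_ rfl
    change x.g - c * p * x.g ^ 2 + c * p * (x.g - c * p * x.g ^ 2) ^ 2 = x.g
    linear_combination (-2 * c ^ 2 * x.g ^ 3 + c ^ 3 * p * x.g ^ 4) * p_sq_eq_zero p
  right_inv x := by
    refine Prod.ext ?_ rfl
    change x.1.toAdd + c * p * x.1.toAdd ^ 2 - c * p * (x.1.toAdd + c * p * x.1.toAdd ^ 2) ^ 2
      = x.1.toAdd
    linear_combination
      (-2 * c ^ 2 * x.1.toAdd ^ 3 - c ^ 3 * p * x.1.toAdd ^ 4) * p_sq_eq_zero p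
  map_mul' x y := by
    refine Prod.ext ?_ rfl
    change x.g + y.g + p * x.g * y.g - c * p * (x.g + y.g + p * x.g * y.g) ^ 2 =
      x.g - c * p * x.g ^ 2 + (y.g - c * p * y.g ^ 2)
    linear_combination (-p * x.g * y.g) * hc -
      (2 * c * (x.g + y.g) * x.g * y.g + c * p * x.g ^ 2 * y.g ^ 2) * p_sq_eq_zero p

theorem nonempty_mulEquivProd (hp : p.Prime) (hp2 : 2 < p) :
    Nonempty (DirectNontrivial p ≃* Multiplicative (ZMod (p ^ 2)) × Multiplicative (ZMod 2)) := by
  obtain ⟨c, hc⟩ := (isUnit_two_zmod_sq hp hp2).exists_left_inv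
  exact ⟨mulEquivProd c hc⟩

theorem isCyclic_G (hp : p.Prime) (hp2 : 2 < p) :
    IsCyclic (LeftSemiBrace.G (DirectNontrivial p)) := by
  obtain ⟨c, hc⟩ := (isUnit_two_zmod_sq hp hp2).exists_left_inv
  have he (x : LeftSemiBrace.G (DirectNontrivial p)) : x.1.e = 0 := coe_G_eq.subset x.2
  refine isCyclic_of_injective (((MonoidHom.fst _ _).comp (mulEquivProd c hc).toMonoidHom).comp
    (LeftSemiBrace.G (DirectNontrivial p)).subtype) fun x y h => ?_
  refine Subtype.ext ((mulEquivProd c hc).injective (Prod.ext h ?_))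
  exact congrArg Multiplicative.ofAdd ((he x).trans (he y).symm)

end DirectNontrivial

theorem natCard_zmod_sq_prod (p : ℕ) : Nat.card (ZMod (p ^ 2) × ZMod 2) = 2 * p ^ 2 := by
  rw [Nat.card_prod, Nat.card_zmod, Nat.card_zmod, mul_comm]

theorem natCard_setOf_fst_eq_zero {p : ℕ} {C : Type*} (mk : ZMod (p ^ 2) × ZMod 2 ≃ C)
    (S : Set C) (hS : ∀ a i, mk (a, i) ∈ S ↔ a = 0) : Nat.card S = 2 := by
  have hS' : S = Set.range fun i => mk (0, i) := by
    ext x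
    obtain ⟨⟨a, i⟩, rfl⟩ := mk.surjective x
    rw [hS]
    constructor
    · rintro rfl
      exact ⟨i, rfl⟩
    · rintro ⟨j, hj⟩
      exact (congrArg Prod.fst (mk.injective hj)).symm
  rw [hS', Nat.card_range_of_injective fun i j h => congrArg Prod.snd (mk.injective h),
    Nat.card_zmod]

/-! ### Classification -/

namespace LeftSemiBrace

theorem isomorphic_of_equiv_prod {B C ι A : Type*} [LeftSemiBrace B] [LeftSemiBrace C]
    (Φ : A × ι ≃ B) (Ψ : A × ι ≃ C)
    (hadd : ∀ x y, Φ.symm (Φ x + Φ y) = Ψ.symm (Ψ x + Ψ y))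
    (hmul : ∀ x y, Φ.symm (Φ x * Φ y) = Ψ.symm (Ψ x * Ψ y)) : Isomorphic B C := by
  refine ⟨Φ.symm.trans Ψ, fun x y => ?_, fun x y => ?_⟩
  · simpa using congrArg Ψ (hadd (Φ.symm x) (Φ.symm y))
  · simpa using congrArg Ψ (hmul (Φ.symm x) (Φ.symm y))

theorem isomorphic_model_of_isCyclic_G {p : ℕ} (hp : p.Prime) (hp2 : 2 < p)
    {α : ZMod 2 →+ AddAut (ZMod (p ^ 2))} (hα : Function.Injective α)
    (B : Type*) [LeftSemiBrace B] [IsLeftCancelAdd B] (hcard : Nat.card B = 2 * p ^ 2)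
    (hE : Nat.card (E B) = 2) (hG : IsCyclic (G B)) :
    Isomorphic B (SemidirectTrivial p α) ∨ Isomorphic B (DirectTrivial p) ∨
      Isomorphic B (DirectNontrivial p) := by
  have hcardG : Nat.card (G B) = p ^ 2 := by
    have h := card_eq_card_G_mul_card_E (B := B)
    rw [hcard, hE] at h
    omega
  obtain ⟨f, hf⟩ := exists_addEquiv_zmod_sq hp hp2 hcardG lamG mul_eq_add_lamG lamG_mul
  obtain ⟨Φ, φ, hφmul, hφφ, hΦadd, hΦmul⟩ := exists_equiv_prod_zmod_two hE
  -- In the coordinate `f`, the involution `φ` is multiplication by some `u` with `u * u = 1`.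
  obtain ⟨u, hu⟩ : ∃ u, ∀ g, f (φ g) = u * f g :=
    ⟨f (φ (f.symm 1)), fun g => by
      simpa using addMonoidHom_apply_zmod
        ((f.toAddMonoidHom.comp φ).comp f.symm.toAddMonoidHom) (f g)⟩
  have huu : u * u = 1 := by
    have h := congrArg f (hφφ (f.symm 1))
    rw [hu, hu, f.apply_symm_apply, mul_one] at h
    exact h
  have hu1 := eq_one_or_eq_neg_one_of_sq_eq_one hp hp2 huu
  have hz : ∀ i : ZMod 2, i = 0 ∨ i = 1 := by decide
  let Ψ : ZMod (p ^ 2) × ZMod 2 ≃ B := (f.symm.toEquiv.prodCongr (Equiv.refl _)).trans Φ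
  have hΨ (g : G B) (i : ZMod 2) : Ψ (f g, i) = Φ (g, i) := by simp [Ψ]
  have hiso {C : Type} [LeftSemiBrace C] (mk : ZMod (p ^ 2) × ZMod 2 ≃ C)
      (hadd : ∀ a b i j, mk (a, i) + mk (b, j) = mk (a + b, j))
      (hmul : ∀ g h i j, mk (f g, i) * mk (f h, j) =
        mk (f (g * (if i = 0 then h else φ h)), i + j)) : Isomorphic B C := by
    refine isomorphic_of_equiv_prod Ψ mk ?_ ?_
    all_goals
      rintro ⟨a, i⟩ ⟨b, j⟩
      obtain ⟨g, rfl⟩ := f.surjective a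
      obtain ⟨h, rfl⟩ := f.surjective b
      rw [Equiv.symm_apply_eq, hΨ, hΨ]
    · rw [hΦadd, hadd, Equiv.symm_apply_apply, ← map_add, hΨ]
    · rw [hΦmul, hmul, Equiv.symm_apply_apply, hΨ]
  rcases hf with hf | hf
  · rcases hu1 with rfl | rfl
    · refine Or.inr (Or.inl (hiso (DirectTrivial.equivProd p) (fun _ _ _ _ => rfl) ?_))
      intro g h i j
      refine DirectTrivial.ext ?_ rfl
      change f g + f h = f (g * if i = 0 then h else φ h)
      rw [hf]
      split_ifs
      · rfl
      · rw [hu, one_mul]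
    · refine Or.inl (hiso (SemidirectTrivial.equivProd p α) (fun _ _ _ _ => rfl) ?_)
      intro g h i j
      refine SemidirectTrivial.ext ?_ rfl
      change f g + α i (f h) = f (g * if i = 0 then h else φ h)
      rw [hf]
      rcases hz i with rfl | rfl
      · rw [map_zero, AddAut.zero_apply, if_pos rfl]
      · rw [apply_one_eq_neg_of_injective hp hp2 hα, if_neg one_ne_zero, hu, neg_one_mul]
  · have hu1 : u = 1 := by
      refine hu1.resolve_right ?_
      rintro rfl
      -- Compare the `p`-terms of `φ (g * g)` and `φ g * φ g` for `f g = 1`: they are `-p` and `p`.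
      have h := congrArg f (hφmul (f.symm 1) (f.symm 1))
      rw [hu, hf, hf, hu, f.apply_symm_apply] at h
      have h2 : (2 : ZMod (p ^ 2)) * p = 0 := by linear_combination -h
      exact natCast_prime_zmod_sq_ne_zero hp
        ((isUnit_two_zmod_sq hp hp2).mul_right_eq_zero.1 h2)
    subst hu1
    refine Or.inr (Or.inr (hiso (DirectNontrivial.equivProd p) (fun _ _ _ _ => rfl) ?_))
    intro g h i j
    refine DirectNontrivial.ext ?_ rfl
    change f g + f h + p * f g * f h = f (g * if i = 0 then h else φ h)
    rw [hf]
    split_ifs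
    · rfl
    · rw [hu, one_mul]

end LeftSemiBrace

/-! ### The models are pairwise non-isomorphic -/

section NotIsomorphic

variable {p : ℕ}

theorem LeftSemiBrace.Isomorphic.mul_comm {B C : Type*} [LeftSemiBrace B] [LeftSemiBrace C]
    (h : LeftSemiBrace.Isomorphic B C) (hC : ∀ x y : C, x * y = y * x) (x y : B) :
    x * y = y * x := by
  obtain ⟨f, -, hf⟩ := h
  exact f.injective (by rw [hf, hf, hC])

theorem not_forall_mul_comm_semidirectTrivial (hp : p.Prime) (hp2 : 2 < p)
    {α : ZMod 2 →+ AddAut (ZMod (p ^ 2))} (hα : Function.Injective α) :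
    ¬ ∀ x y : SemidirectTrivial p α, x * y = y * x := by
  intro h
  have h1 := congrArg SemidirectTrivial.g (h ⟨1, 0⟩ ⟨0, 1⟩)
  simp only [SemidirectTrivial.mul_g, map_zero, add_zero, zero_add,
    apply_one_eq_neg_of_injective hp hp2 hα] at h1
  exact one_ne_neg_one_zmod_sq hp2 h1

/-- The two operations agree on the elements `x + 1` in the second model but not in the third. -/
theorem not_isomorphic_directTrivial_directNontrivial (hp : p.Prime) :
    ¬ LeftSemiBrace.Isomorphic (DirectTrivial p) (DirectNontrivial p) := by
  rintro ⟨f, hadd, hmul⟩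
  have h1 : f 1 = 1 := by
    have h := hmul 1 1
    rw [mul_one] at h
    exact left_eq_mul.1 h
  obtain ⟨x, hx⟩ := f.surjective ⟨1, 0⟩
  have h : (x + 1) * (x + 1) = (x + 1) + (x + 1) := by
    ext <;> simp
  have h2 := congrArg f h
  rw [hmul, hadd (x + 1), hadd, h1, hx] at h2
  have h3 := congrArg DirectNontrivial.g h2
  simp only [DirectNontrivial.mul_g, DirectNontrivial.add_g, DirectNontrivial.one_g] at h3
  exact natCast_prime_zmod_sq_ne_zero hp (by linear_combination h3)

end NotIsomorphic

theorem mainTheorem5 (p : ℕ) (hp : p.Prime) (hp2 : 2 < p) :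
    -- there is exactly one injective homomorphism from `ℤ/2ℤ` to `Aut(ℤ/p²ℤ, +)`
    (∃! α : ZMod 2 →+ AddAut (ZMod (p ^ 2)), Function.Injective α) ∧
    ∀ α : ZMod 2 →+ AddAut (ZMod (p ^ 2)), Function.Injective α →
      -- every left semi-brace of the given kind is isomorphic to one of the three
      (∀ (B : Type*) [LeftSemiBrace B] [IsLeftCancelAdd B],
        Nat.card B = 2 * p ^ 2 → Nat.card (LeftSemiBrace.E B) = 2 →
        IsCyclic (LeftSemiBrace.G B) →
          LeftSemiBrace.Isomorphic B (SemidirectTrivial p α) ∨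
          LeftSemiBrace.Isomorphic B (DirectTrivial p) ∨
          LeftSemiBrace.Isomorphic B (DirectNontrivial p)) ∧
      -- the first left semi-brace is of the given kind, with `E`, `G`, `(B, ∘)` as described
      (Nat.card (SemidirectTrivial p α) = 2 * p ^ 2 ∧
        Nat.card (LeftSemiBrace.E (SemidirectTrivial p α)) = 2 ∧
        IsCyclic (LeftSemiBrace.G (SemidirectTrivial p α)) ∧
        LeftSemiBrace.E (SemidirectTrivial p α) = {x | x.g = 0} ∧
        (LeftSemiBrace.G (SemidirectTrivial p α) : Set (SemidirectTrivial p α)) =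
          {x | x.e = 0} ∧
        Nonempty (SemidirectTrivial p α ≃*
          Multiplicative (ZMod (p ^ 2)) ⋊[(MulAutMultiplicative
            (ZMod (p ^ 2))).symm.toMonoidHom.comp (AddMonoidHom.toMultiplicative α)] Multiplicative (ZMod 2))) ∧
      -- the second one
      (Nat.card (DirectTrivial p) = 2 * p ^ 2 ∧
        Nat.card (LeftSemiBrace.E (DirectTrivial p)) = 2 ∧
        IsCyclic (LeftSemiBrace.G (DirectTrivial p)) ∧
        LeftSemiBrace.E (DirectTrivial p) = {x | x.g = 0} ∧
        (LeftSemiBrace.G (DirectTrivial p) : Set (DirectTrivial p)) = {x | x.e = 0} ∧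
        Nonempty (DirectTrivial p ≃*
          Multiplicative (ZMod (p ^ 2)) × Multiplicative (ZMod 2))) ∧
      -- the third one
      (Nat.card (DirectNontrivial p) = 2 * p ^ 2 ∧
        Nat.card (LeftSemiBrace.E (DirectNontrivial p)) = 2 ∧
        IsCyclic (LeftSemiBrace.G (DirectNontrivial p)) ∧
        LeftSemiBrace.E (DirectNontrivial p) = {x | x.g = 0} ∧
        (LeftSemiBrace.G (DirectNontrivial p) : Set (DirectNontrivial p)) = {x | x.e = 0} ∧
        Nonempty (DirectNontrivial p ≃*
          Multiplicative (ZMod (p ^ 2)) × Multiplicative (ZMod 2))) ∧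
      -- no two of the three are isomorphic
      ¬ LeftSemiBrace.Isomorphic (SemidirectTrivial p α) (DirectTrivial p) ∧
      ¬ LeftSemiBrace.Isomorphic (SemidirectTrivial p α) (DirectNontrivial p) ∧
      ¬ LeftSemiBrace.Isomorphic (DirectTrivial p) (DirectNontrivial p) := by
  refine ⟨existsUnique_injective_hom hp hp2, fun α hα =>
    ⟨fun B _ _ => LeftSemiBrace.isomorphic_model_of_isCyclic_G hp hp2 hα B,
      ⟨?_, ?_, SemidirectTrivial.isCyclic_G, SemidirectTrivial.E_eq, SemidirectTrivial.coe_G_eq,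
        ⟨SemidirectTrivial.mulEquivSemidirectProduct⟩⟩,
      ⟨?_, ?_, DirectTrivial.isCyclic_G, DirectTrivial.E_eq, DirectTrivial.coe_G_eq,
        ⟨DirectTrivial.mulEquivProd⟩⟩,
      ⟨?_, ?_, DirectNontrivial.isCyclic_G hp hp2, DirectNontrivial.E_eq,
        DirectNontrivial.coe_G_eq, DirectNontrivial.nonempty_mulEquivProd hp hp2⟩,
      fun h => not_forall_mul_comm_semidirectTrivial hp hp2 hα (h.mul_comm fun x y => ?_),
      fun h => not_forall_mul_comm_semidirectTrivial hp hp2 hα (h.mul_comm fun x y => ?_),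
      not_isomorphic_directTrivial_directNontrivial hp⟩⟩
  · rw [← natCard_zmod_sq_prod, Nat.card_congr (SemidirectTrivial.equivProd p α)]
  · rw [SemidirectTrivial.E_eq]
    exact natCard_setOf_fst_eq_zero (SemidirectTrivial.equivProd p α) _ fun _ _ => Iff.rfl
  · rw [← natCard_zmod_sq_prod, Nat.card_congr (DirectTrivial.equivProd p)]
  · rw [DirectTrivial.E_eq]
    exact natCard_setOf_fst_eq_zero (DirectTrivial.equivProd p) _ fun _ _ => Iff.rfl
  · rw [← natCard_zmod_sq_prod, Nat.card_congr (DirectNontrivial.equivProd p)]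
  · rw [DirectNontrivial.E_eq]
    exact natCard_setOf_fst_eq_zero (DirectNontrivial.equivProd p) _ fun _ _ => Iff.rfl
  · exact DirectTrivial.ext (add_comm _ _) (add_comm _ _)
  · exact DirectNontrivial.ext (by simp only [DirectNontrivial.mul_g]; ring) (add_comm _ _)
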